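/- Let $K\ge 3$ and $\sigma>0$. There are $K$ arms; in an environment $v$ with mean rewards $(\mu_{v,i})_{i=1}^K$, playing arm $i$ yields an independent reward with law $v(i)=N(\mu_{v,i},\sigma^2)$. Let $V_{K,1}$ be the set of environments with exactly one change point, i.e. exactly one $x^*_v\in\{1,\dots,K-1\}$ with $\mu_{v,x^*_v}\ne\mu_{v,x^*_v+1}$, and let $\Delta=|\mu_{v,x^*_v}-\mu_{v,x^*_v+1}|$ be its magnitude. A policy $\pi$ (possibly randomised) consists of a sampling rule choosing the arm of each round from the past observations, a stopping time $\tau$ of the observation filtration (the number of rounds played), and an estimate $\hat x_\tau\in\{1,\dots,K-1\}$ measurable with respect to the observations up to $\tau$; $\mathbb P_{\pi,v}$ is the law of its interaction with $v$. For $\delta\in(0,1)$, $\pi$ is Exact-$(1,\delta)$ if for all $v\in V_{K,1}$: $\mathbb P_{\pi,v}(\hat x_\tau=x^*_v)>1-\delta$ and $\mathbb P_{\pi,v}(\tau<\infty)=1$. Let $D$ be the Kullback–Leibler divergence, $\mathcal P_K$ the simplex of probability vectors on the $K$ arms, and $$c^*(v)^{-1}=\sup_{\alpha\in\mathcal P_K}\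 \inf_{v'\in V_{K,1},\ x^*_{v'}\neq x^*_v}\ \sum_{i=1}^K\alpha_i D\big(v(i),v'(i)\big).$$ Then for every $v\in V_{K,1}$ with change of magnitude $\Delta$: (i) for every $\delta\in(0,1)$ and every Exact-$(1,\delta)$ policy $\pi$ with stopping time $\tau$, $$\mathbb E_{\pi,v}[\tau]\ \ge\ \frac{8\sigma^2}{\Delta^2}\log\Big(\frac1{4\delta}\Big);$$ (ii) the supremum over $\alpha$ is attained at exactly one $\alpha^*\in\mathcal P_K$, namely $\alpha^*_{x^*_v}=\alpha^*_{x^*_v+1}=\tfrac12$ and $\alpha^*_i=0$ for all other $i$; (iii) $c^*(v)^{-1}=\Delta^2/(8\sigma^2)$. -/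

import Mathlib

open MeasureTheory ProbabilityTheory
open scoped ENNReal NNReal

namespace ChangePointBandit

noncomputable section

/-! Throughout there are `K = n + 1` arms, indexed by `Fin (n + 1)`, and the possible change points
`[K - 1]` are indexed by `Fin n`: a change at `j` is a change between the adjacent arms `j.castSucc`
and `j.succ`. An environment is given by its vector of mean rewards. -/

/-- The set of change points of a vector of means. -/
def changePoints {n : ℕ} (v : Fin (n + 1) → ℝ) : Finset (Fin n) :=
  {j | v j.castSucc ≠ v j.succ}

/-- The environments `V_{K,N}` with `K = n + 1` arms and exactly `N` change points, any two of
which are separated by at least one arm (a void requirement for `N = 1`). -/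
def environments (n N : ℕ) : Set (Fin (n + 1) → ℝ) :=
  {v | (changePoints v).card = N ∧
    ∀ i ∈ changePoints v, ∀ j ∈ changePoints v, i < j → (i : ℕ) + 1 < (j : ℕ)}

/-- The magnitude of the change in mean at `j`. -/
def changeSize {n : ℕ} (v : Fin (n + 1) → ℝ) (j : Fin n) : ℝ :=
  |v j.castSucc - v j.succ|

/-! ### Interaction of a policy with an environment -/

/-- What the learner sees at time `t`: at time `0` a draw from its own internal randomisation, and
in each round `t ≥ 1` the arm played and the reward received. -/
abbrev Obs (n : ℕ) : ℕ → Type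
  | 0 => ℝ
  | _ + 1 => Fin (n + 1) × ℝ

instance instMeasurableSpaceObs (n : ℕ) : (t : ℕ) → MeasurableSpace (Obs n t)
  | 0 => inferInstanceAs (MeasurableSpace ℝ)
  | _ + 1 => inferInstanceAs (MeasurableSpace (Fin (n + 1) × ℝ))

/-- Everything observed up to the end of round `t`. -/
abbrev History (n t : ℕ) : Type := (i : Finset.Iic t) → Obs n i

/-- Infinite sequences of observations. -/
abbrev Trajectory (n : ℕ) : Type := (t : ℕ) → Obs n t

/-- The filtration generated by the observations. -/
abbrev obsFiltration (n : ℕ) :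
    Filtration ℕ (inferInstance : MeasurableSpace (Trajectory n)) :=
  Filtration.piLE (X := Obs n)

/-- A (possibly randomised) policy for locating a single change point. -/
structure Policy (n : ℕ) where
  /-- Law of the internal randomisation. -/
  seedLaw : Measure ℝ
  /-- It is a probability measure. -/
  isProb_seedLaw : IsProbabilityMeasure seedLaw
  /-- Sampling rule: the conditional law of the arm played in round `t + 1`, given the first
  `t` rounds. -/
  sampling : (t : ℕ) → Kernel (History n t) (Fin (n + 1))
  /-- The sampling rule always plays an arm. -/
  isMarkov_sampling : ∀ t, IsMarkovKernel (sampling t)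
  /-- Stopping rule: the number of rounds played before stopping, possibly infinite. -/
  stoppingTime : Trajectory n → ℕ∞
  /-- The decision to stop uses only past observations. -/
  isStoppingTime : IsStoppingTime (obsFiltration n) stoppingTime
  /-- Recommendation rule: the estimated change point. -/
  estimate : Trajectory n → Fin n
  /-- The estimate uses only what has been observed up to the stopping time. -/
  measurable_estimate : Measurable[isStoppingTime.measurableSpace] estimate

/-- The reward distribution `N(v i, σ²)` of each arm `i`, as a Markov kernel. -/
def rewardKernel {n : ℕ} (σ : ℝ≥0) (v : Fin (n + 1) → ℝ) : Kernel (Fin (n + 1)) ℝ where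
  toFun i := gaussianReal (v i) (σ ^ 2)
  measurable' := measurable_from_top

instance instIsMarkovKernelRewardKernel {n : ℕ} (σ : ℝ≥0) (v : Fin (n + 1) → ℝ) :
    IsMarkovKernel (rewardKernel σ v) :=
  ⟨fun i => inferInstanceAs (IsProbabilityMeasure (gaussianReal (v i) (σ ^ 2)))⟩

namespace Policy

variable {n : ℕ}

instance (π : Policy n) : IsProbabilityMeasure π.seedLaw := π.isProb_seedLaw

instance (π : Policy n) (t : ℕ) : IsMarkovKernel (π.sampling t) := π.isMarkov_sampling t

/-- One round: an arm is drawn by the sampling rule and then a reward from the law of that arm. -/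
def roundKernel (π : Policy n) (σ : ℝ≥0) (v : Fin (n + 1) → ℝ) (t : ℕ) :
    Kernel (History n t) (Obs n (t + 1)) :=
  π.sampling t ⊗ₖ Kernel.prodMkLeft (History n t) (rewardKernel σ v)

instance (π : Policy n) (σ : ℝ≥0) (v : Fin (n + 1) → ℝ) (t : ℕ) :
    IsMarkovKernel (π.roundKernel σ v t) :=
  inferInstanceAs
    (IsMarkovKernel (π.sampling t ⊗ₖ Kernel.prodMkLeft (History n t) (rewardKernel σ v)))

/-- The law `ℙ_{π,v}` of the interaction between the policy `π` and the environment `v`, when the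
noise has standard deviation `σ`. -/
def law (π : Policy n) (σ : ℝ≥0) (v : Fin (n + 1) → ℝ) : Measure (Trajectory n) :=
  Kernel.trajMeasure (X := Obs n) π.seedLaw (π.roundKernel σ v)

instance (π : Policy n) (σ : ℝ≥0) (v : Fin (n + 1) → ℝ) : IsProbabilityMeasure (π.law σ v) :=
  inferInstanceAs
    (IsProbabilityMeasure (Kernel.trajMeasure (X := Obs n) π.seedLaw (π.roundKernel σ v)))

/-- The expected stopping time `𝔼_{π,v}[τ]`. -/
def expectedStop (π : Policy n) (σ : ℝ≥0) (v : Fin (n + 1) → ℝ) : ℝ≥0∞ :=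
  ∫⁻ ω, (π.stoppingTime ω : ℝ≥0∞) ∂(π.law σ v)

/-- Exact-`(1,δ)` policies: in every environment with exactly one change point `x`, the policy stops
almost surely and returns `x` with probability greater than `1 - δ`. -/
def IsExactOne (π : Policy n) (σ : ℝ≥0) (δ : ℝ) : Prop :=
  ∀ v ∈ environments n 1,
    (∀ x ∈ changePoints v, 1 - δ < (π.law σ v).real {ω | π.estimate ω = x}) ∧
    ∀ᵐ ω ∂(π.law σ v), π.stoppingTime ω < ⊤

end Policy

/-! ### The max-min problem -/

/-- `V^{alt}_{K,1}`: the environments with exactly one change point, different from that of `v`. -/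
def alternatives {n : ℕ} (v : Fin (n + 1) → ℝ) : Set (Fin (n + 1) → ℝ) :=
  {v' | v' ∈ environments n 1 ∧ changePoints v' ≠ changePoints v}

/-- The inner infimum `inf_{v'} ∑ᵢ αᵢ D(v(i), v'(i))` of the max-min problem. -/
def allocationValue {n : ℕ} (σ : ℝ≥0) (v : Fin (n + 1) → ℝ) (α : Fin (n + 1) → ℝ) : ℝ≥0∞ :=
  ⨅ v' ∈ alternatives v, ∑ i, ENNReal.ofReal (α i) *
    InformationTheory.klDiv (gaussianReal (v i) (σ ^ 2)) (gaussianReal (v' i) (σ ^ 2))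

/-- The characteristic time `c*(v)`, the inverse of the value of the max-min problem. -/
def cStar {n : ℕ} (σ : ℝ≥0) (v : Fin (n + 1) → ℝ) : ℝ≥0∞ :=
  (⨆ α ∈ stdSimplex ℝ (Fin (n + 1)), allocationValue σ v α)⁻¹

/-- The allocations attaining the maximum in the max-min problem. -/
def optimalAllocations {n : ℕ} (σ : ℝ≥0) (v : Fin (n + 1) → ℝ) : Set (Fin (n + 1) → ℝ) :=
  {α | α ∈ stdSimplex ℝ (Fin (n + 1)) ∧
    IsMaxOn (allocationValue σ v) (stdSimplex ℝ (Fin (n + 1))) α}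

end

end ChangePointBandit

/-! Two Gaussians of common variance `σ²` have divergence equal to the squared difference of their
means over `2σ²`, so an alternative costs a weighted squared distance to `v`. Write `a` and `b` for
the two levels of `v`. As there are at least three arms, a second position for the change exists,
and putting the change there with `(a + b) / 2` as one of the levels moves each arm by at most `Δ /
2` (`exists_alternative_near`). No allocation can therefore exceed `Δ² / (8σ²)`. Conversely, an
alternative gives both arms adjacent to `x` a common mean, and the even split over these two arms
makes that cost at least `Δ² / (8σ²)`. Uniqueness comes from one-parameter families of alternatives
with the change at a neighbour of `x`: their cost is quadratic in the parameter and stays above the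
optimum only if the masses concerned are one half each (`eq_half_of_quadratic_ge`).

For the stopping time, the same near alternative `w` suffices: every arm yields at most `c = Δ² /
(8σ²)` of expected log-likelihood ratio per round, whatever the sampling rule. The ratio stopped at
`min τ t` thus has mean at most `c 𝔼[min τ t]` under `v`. The Bretagnolle–Huber inequality, applied
to the event that `x` is returned by time `t`, bounds `exp (-c 𝔼[min τ t]) / 2` by the sum of two
error probabilities, each below `δ` for large `t`. Truncating at `t` keeps everything integrable
without assuming `𝔼[τ] < ∞`. -/

namespace ChangePointBandit

noncomputable section

/-! ### Gaussian likelihood ratios -/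

/-- The log-likelihood ratio at `r` of `N(m, s)` with respect to `N(m', s)`. -/
def gaussianLogRatio (s m m' r : ℝ) : ℝ := ((r - m') ^ 2 - (r - m) ^ 2) / (2 * s)

lemma measurable_exp_neg_gaussianLogRatio (s m m' : ℝ) :
    Measurable fun r ↦ ENNReal.ofReal (Real.exp (-gaussianLogRatio s m m' r)) := by
  unfold gaussianLogRatio; fun_prop

lemma gaussianReal_eq_withDensity {s : ℝ≥0} (hs : s ≠ 0) (m m' : ℝ) :
    gaussianReal m' s = (gaussianReal m s).withDensity
      fun r ↦ ENNReal.ofReal (Real.exp (-gaussianLogRatio s m m' r)) := by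
  rw [gaussianReal_of_var_ne_zero _ hs, gaussianReal_of_var_ne_zero _ hs,
    ← withDensity_mul _ (measurable_gaussianPDF _ _)
      (measurable_exp_neg_gaussianLogRatio _ _ _)]
  congr 1
  ext r
  simp only [Pi.mul_apply, gaussianPDF]
  rw [← ENNReal.ofReal_mul (gaussianPDFReal_nonneg _ _ _)]
  simp only [gaussianPDFReal]
  rw [mul_assoc _ (Real.exp _) (Real.exp _), ← Real.exp_add]
  congr 3
  have : (s : ℝ) ≠ 0 := by exact_mod_cast hs
  rw [gaussianLogRatio]
  field_simp
  ring

lemma gaussianLogRatio_eq {s : ℝ≥0} (hs : s ≠ 0) (m m' r : ℝ) :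
    gaussianLogRatio s m m' r = (m - m') / s * r + (m' ^ 2 - m ^ 2) / (2 * s) := by
  have : (s : ℝ) ≠ 0 := by exact_mod_cast hs
  rw [gaussianLogRatio]
  field_simp
  ring

lemma integrable_id_gaussianReal (m : ℝ) (s : ℝ≥0) :
    Integrable (fun r : ℝ ↦ r) (gaussianReal m s) :=
  (memLp_id_gaussianReal (μ := m) (v := s) 1).integrable le_rfl

lemma integrable_gaussianLogRatio {s : ℝ≥0} (hs : s ≠ 0) (m m' : ℝ) :
    Integrable (gaussianLogRatio s m m') (gaussianReal m s) := by
  simp_rw [funext (gaussianLogRatio_eq hs m m')]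
  exact ((integrable_id_gaussianReal m s).const_mul _).add (integrable_const _)

lemma integral_gaussianLogRatio {s : ℝ≥0} (hs : s ≠ 0) (m m' : ℝ) :
    ∫ r, gaussianLogRatio s m m' r ∂(gaussianReal m s) = (m - m') ^ 2 / (2 * s) := by
  simp_rw [gaussianLogRatio_eq hs m m']
  rw [integral_add ((integrable_id_gaussianReal m s).const_mul _) (integrable_const _),
    integral_const_mul, integral_id_gaussianReal, integral_const]
  have : (s : ℝ) ≠ 0 := by exact_mod_cast hs
  simp
  field_simp
  ring

lemma gaussianLogRatio_swap (s m m' r : ℝ) :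
    -gaussianLogRatio s m m' r = gaussianLogRatio s m' m r := by
  simp only [gaussianLogRatio]; ring

lemma klDiv_gaussianReal {s : ℝ≥0} (hs : s ≠ 0) (m m' : ℝ) :
    InformationTheory.klDiv (gaussianReal m s) (gaussianReal m' s) =
      ENNReal.ofReal ((m - m') ^ 2 / (2 * s)) := by
  have hac : gaussianReal m s ≪ gaussianReal m' s :=
    (gaussianReal_absolutelyContinuous m hs).trans (gaussianReal_absolutelyContinuous' m' hs)
  have hllr : llr (gaussianReal m s) (gaussianReal m' s) =ᵐ[gaussianReal m s]
      gaussianLogRatio s m m' := by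
    -- The formula for `rnDeriv` holds almost everywhere under `N(m', s)`; absolute continuity
    -- carries it over to `N(m, s)`.
    refine hac.ae_le ?_
    have h := Measure.rnDeriv_withDensity (gaussianReal m' s)
      (measurable_exp_neg_gaussianLogRatio s m' m)
    rw [← gaussianReal_eq_withDensity hs m' m] at h
    filter_upwards [h] with r hr
    rw [llr, hr, ENNReal.toReal_ofReal (Real.exp_pos _).le, Real.log_exp]
    exact gaussianLogRatio_swap _ _ _ _
  rw [InformationTheory.klDiv_of_ac_of_integrable hac
    ((integrable_congr hllr).2 (integrable_gaussianLogRatio hs m m')),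
    integral_congr_ae hllr, integral_gaussianLogRatio hs]
  simp

/-! ### Environments with one change point -/

/-- The vector of means equal to `c` up to arm `y` and to `d` afterwards. -/
def stepMeans {n : ℕ} (y : Fin n) (c d : ℝ) : Fin (n + 1) → ℝ :=
  fun i ↦ if i ≤ y.castSucc then c else d

lemma changePoints_stepMeans {n : ℕ} (y : Fin n) {c d : ℝ} (h : c ≠ d) :
    changePoints (stepMeans y c d) = {y} := by
  ext z
  simp only [changePoints, stepMeans, Finset.mem_filter, Finset.mem_univ, true_and,
    Finset.mem_singleton, Fin.le_def, Fin.ext_iff, Fin.val_castSucc, Fin.val_succ]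
  split_ifs <;> simp [h] <;> omega

lemma stepMeans_mem_environments {n : ℕ} (y : Fin n) {c d : ℝ} (h : c ≠ d) :
    stepMeans y c d ∈ environments n 1 := by
  simp [environments, changePoints_stepMeans y h]

lemma changePoints_eq_singleton {n : ℕ} {v : Fin (n + 1) → ℝ} (hv : v ∈ environments n 1)
    {x : Fin n} (hx : x ∈ changePoints v) : changePoints v = {x} := by
  obtain ⟨y, hy⟩ := Finset.card_eq_one.1 hv.1
  rw [hy, Finset.mem_singleton] at hx
  rw [hy, hx]

/-- The difference of the two vectors does not jump between any adjacent arms, so it is constant,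
and it vanishes at `x.castSucc`. -/
lemma eq_stepMeans {n : ℕ} {v : Fin (n + 1) → ℝ} (hv : v ∈ environments n 1)
    {x : Fin n} (hx : x ∈ changePoints v) :
    v = stepMeans x (v x.castSucc) (v x.succ) := by
  set w := stepMeans x (v x.castSucc) (v x.succ) with hw
  have hstep : ∀ j : Fin n, v j.castSucc - w j.castSucc = v j.succ - w j.succ := by
    intro j
    by_cases hj : j = x
    · subst hj
      simp [hw, stepMeans]
    · have hvj : v j.castSucc = v j.succ := by
        have : j ∉ changePoints v := by simpa [changePoints_eq_singleton hv hx] using hj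
        simpa [changePoints] using this
      have hwj : w j.castSucc = w j.succ := by
        have : j.castSucc ≤ x.castSucc ↔ j.succ ≤ x.castSucc := by
          simp only [Fin.le_def, Fin.ext_iff, Fin.val_castSucc, Fin.val_succ] at hj ⊢
          omega
        simp only [hw, stepMeans, this]
      rw [hvj, hwj]
  have hconst : ∀ i, v i - w i = v 0 - w 0 := by
    intro i
    induction i using Fin.induction with
    | zero => rfl
    | succ j ih => rw [← hstep, ih]
  have hzero : v 0 - w 0 = 0 := by rw [← hconst x.castSucc]; simp [hw, stepMeans]
  ext i
  linarith [hconst i]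

lemma ne_of_mem_changePoints {n : ℕ} {v : Fin (n + 1) → ℝ} {x : Fin n}
    (hx : x ∈ changePoints v) : v x.castSucc ≠ v x.succ := by
  simpa [changePoints] using hx

lemma stepMeans_mem_alternatives {n : ℕ} {v : Fin (n + 1) → ℝ} (hv : v ∈ environments n 1)
    {x : Fin n} (hx : x ∈ changePoints v) {y : Fin n} (hy : y ≠ x) {c d : ℝ} (h : c ≠ d) :
    stepMeans y c d ∈ alternatives v := by
  refine ⟨stepMeans_mem_environments y h, ?_⟩
  rw [changePoints_stepMeans y h, changePoints_eq_singleton hv hx]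
  simpa using hy

/-- Some alternative environment differs from `v` in each arm by at most half the change size. -/
lemma exists_alternative_near {n : ℕ} (hn : 2 ≤ n) {v : Fin (n + 1) → ℝ}
    (hv : v ∈ environments n 1) {x : Fin n} (hx : x ∈ changePoints v) :
    ∃ y, y ≠ x ∧ ∃ w ∈ alternatives v, y ∈ changePoints w ∧
      ∀ i, (v i - w i) ^ 2 ≤ changeSize v x ^ 2 / 4 := by
  have : Nontrivial (Fin n) := Fin.nontrivial_iff_two_le.2 hn
  obtain ⟨y, hy⟩ := exists_ne x
  have hne := ne_of_mem_changePoints hx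
  have hstep := eq_stepMeans hv hx
  set a := v x.castSucc with ha
  set b := v x.succ with hb
  have hsize : changeSize v x ^ 2 = (a - b) ^ 2 := by rw [changeSize, sq_abs]
  refine ⟨y, hy, ?_⟩
  -- For `y < x` the levels of the alternative are `a` and the midpoint; for `x < y` they are the
  -- midpoint and `b`. Either way the arms on one side of `y` keep their means and the others move
  -- by half the gap.
  rcases lt_or_gt_of_ne hy with hlt | hlt
  · have h : a ≠ (a + b) / 2 := fun h ↦ hne (by linarith)
    refine ⟨_, stepMeans_mem_alternatives hv hx hy h, by simp [changePoints_stepMeans y h],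
      fun i ↦ ?_⟩
    rw [hsize, hstep]
    simp only [stepMeans]
    split_ifs with h1 h2 h2
    · nlinarith [sq_nonneg (a - b)]
    · nlinarith [sq_nonneg (a - b)]
    · exact absurd (h2.trans (Fin.castSucc_le_castSucc_iff.2 hlt.le)) h1
    · nlinarith [sq_nonneg (a - b)]
  · have h : (a + b) / 2 ≠ b := fun h ↦ hne (by linarith)
    refine ⟨_, stepMeans_mem_alternatives hv hx hy h, by simp [changePoints_stepMeans y h],
      fun i ↦ ?_⟩
    rw [hsize, hstep]
    simp only [stepMeans]
    split_ifs with h1 h2 h2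
    · nlinarith [sq_nonneg (a - b)]
    · exact absurd (h1.trans (Fin.castSucc_le_castSucc_iff.2 hlt.le)) h2
    · nlinarith [sq_nonneg (a - b)]
    · nlinarith [sq_nonneg (a - b)]

/-! ### The max-min problem -/

lemma sum_mul_klDiv {n : ℕ} {σ : ℝ≥0} (hσ : 0 < σ) (v w : Fin (n + 1) → ℝ)
    {α : Fin (n + 1) → ℝ} (hα : ∀ i, 0 ≤ α i) :
    ∑ i, ENNReal.ofReal (α i) *
        InformationTheory.klDiv (gaussianReal (v i) (σ ^ 2)) (gaussianReal (w i) (σ ^ 2)) =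
      ENNReal.ofReal ((∑ i, α i * (v i - w i) ^ 2) / (2 * (σ : ℝ) ^ 2)) := by
  rw [Finset.sum_div, ENNReal.ofReal_sum_of_nonneg
    fun i _ ↦ div_nonneg (mul_nonneg (hα i) (sq_nonneg _)) (by positivity)]
  refine Finset.sum_congr rfl fun i _ ↦ ?_
  rw [klDiv_gaussianReal (pow_pos hσ 2).ne', ← ENNReal.ofReal_mul (hα i), mul_div_assoc]
  simp

lemma allocationValue_le {n : ℕ} {σ : ℝ≥0} (hσ : 0 < σ) {v w : Fin (n + 1) → ℝ}
    (hw : w ∈ alternatives v) {α : Fin (n + 1) → ℝ} (hα : ∀ i, 0 ≤ α i) :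
    allocationValue σ v α ≤
      ENNReal.ofReal ((∑ i, α i * (v i - w i) ^ 2) / (2 * (σ : ℝ) ^ 2)) :=
  (iInf₂_le w hw).trans_eq (sum_mul_klDiv hσ v w hα)

lemma allocationValue_le_of_mem_stdSimplex {n : ℕ} (hn : 2 ≤ n) {σ : ℝ≥0} (hσ : 0 < σ)
    {v : Fin (n + 1) → ℝ} (hv : v ∈ environments n 1) {x : Fin n} (hx : x ∈ changePoints v)
    {α : Fin (n + 1) → ℝ} (hα : α ∈ stdSimplex ℝ (Fin (n + 1))) :
    allocationValue σ v α ≤ ENNReal.ofReal (changeSize v x ^ 2 / (8 * (σ : ℝ) ^ 2)) := by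
  obtain ⟨y, -, w, hw, -, hle⟩ := exists_alternative_near hn hv hx
  refine (allocationValue_le hσ hw hα.1).trans (ENNReal.ofReal_le_ofReal ?_)
  have hσ' : (0 : ℝ) < σ := hσ
  calc (∑ i, α i * (v i - w i) ^ 2) / (2 * (σ : ℝ) ^ 2)
      ≤ (∑ i, α i * (changeSize v x ^ 2 / 4)) / (2 * (σ : ℝ) ^ 2) := by
        gcongr with i
        · exact hα.1 i
        · exact hle i
    _ = changeSize v x ^ 2 / (8 * (σ : ℝ) ^ 2) := by
        rw [← Finset.sum_mul, hα.2]
        field_simp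
        ring

/-- The allocation that splits its mass evenly over the two arms adjacent to `x`. -/
def evenAllocation {n : ℕ} (x : Fin n) : Fin (n + 1) → ℝ :=
  fun i ↦ if i = x.castSucc ∨ i = x.succ then 1 / 2 else 0

lemma sum_evenAllocation_mul {n : ℕ} (x : Fin n) (f : Fin (n + 1) → ℝ) :
    ∑ i, evenAllocation x i * f i = (f x.castSucc + f x.succ) / 2 := by
  have hne : x.castSucc ≠ x.succ := Fin.castSucc_lt_succ.ne
  have : ∀ i, evenAllocation x i * f i =
      (if i = x.castSucc then f i / 2 else 0) + if i = x.succ then f i / 2 else 0 := by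
    intro i
    by_cases h1 : i = x.castSucc
    · subst h1; simp [evenAllocation, hne]; ring
    · by_cases h2 : i = x.succ
      · subst h2; simp [evenAllocation, hne.symm]; ring
      · simp [evenAllocation, h1, h2]
  simp_rw [this, Finset.sum_add_distrib, Finset.sum_ite_eq', Finset.mem_univ, if_true]
  ring

lemma evenAllocation_mem_stdSimplex {n : ℕ} (x : Fin n) :
    evenAllocation x ∈ stdSimplex ℝ (Fin (n + 1)) := by
  refine ⟨fun i ↦ ?_, ?_⟩
  · rw [evenAllocation]; split_ifs <;> norm_num
  · simpa using sum_evenAllocation_mul x fun _ ↦ 1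

/-- An alternative has no change at `x`, hence a common mean `m` on the two adjacent arms, and `(a -
m)² + (b - m)² = (a - b)² / 2 + (a + b - 2m)² / 2`. -/
lemma le_allocationValue_evenAllocation {n : ℕ} {σ : ℝ≥0} (hσ : 0 < σ)
    {v : Fin (n + 1) → ℝ} (hv : v ∈ environments n 1) {x : Fin n} (hx : x ∈ changePoints v) :
    ENNReal.ofReal (changeSize v x ^ 2 / (8 * (σ : ℝ) ^ 2)) ≤
      allocationValue σ v (evenAllocation x) := by
  refine le_iInf₂ fun w hw ↦ ?_
  have hσ' : (0 : ℝ) < σ := hσ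
  rw [sum_mul_klDiv hσ v w (evenAllocation_mem_stdSimplex x).1, sum_evenAllocation_mul]
  refine ENNReal.ofReal_le_ofReal ?_
  have hxw : w x.castSucc = w x.succ := by
    by_contra h
    have hxw : x ∈ changePoints w := by simpa [changePoints] using h
    exact hw.2 ((changePoints_eq_singleton hw.1 hxw).trans (changePoints_eq_singleton hv hx).symm)
  rw [changeSize, sq_abs, hxw, div_le_div_iff₀ (by positivity) (by positivity)]
  have := mul_nonneg (sq_nonneg (σ : ℝ)) (sq_nonneg (v x.castSucc + v x.succ - 2 * w x.succ))
  nlinarith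

lemma iSup_allocationValue {n : ℕ} (hn : 2 ≤ n) {σ : ℝ≥0} (hσ : 0 < σ)
    {v : Fin (n + 1) → ℝ} (hv : v ∈ environments n 1) {x : Fin n} (hx : x ∈ changePoints v) :
    ⨆ α ∈ stdSimplex ℝ (Fin (n + 1)), allocationValue σ v α =
      ENNReal.ofReal (changeSize v x ^ 2 / (8 * (σ : ℝ) ^ 2)) :=
  le_antisymm (iSup₂_le fun _ hα ↦ allocationValue_le_of_mem_stdSimplex hn hσ hv hx hα)
    ((le_allocationValue_evenAllocation hσ hv hx).trans
      (le_iSup₂_of_le _ (evenAllocation_mem_stdSimplex x) le_rfl))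

/-- Taking `t = 1 / 2` forces `A + B = 1`; the quadratic then has its minimum `B (1 - B)` at `t =
B`, which reaches `1 / 4` only for `B = 1 / 2`. The value `t = 1` is excluded because the families
of environments it serves lose their change there. -/
lemma eq_half_of_quadratic_ge {A B : ℝ} (hA : 0 ≤ A) (hB : 0 ≤ B) (hAB : A + B ≤ 1)
    (h : ∀ t : ℝ, t ≠ 1 → 1 / 4 ≤ A * t ^ 2 + B * (1 - t) ^ 2) : A = 1 / 2 ∧ B = 1 / 2 := by
  have h1 := h (1 / 2) (by norm_num)
  have hsum : A = 1 - B := by linarith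
  subst hsum
  have hB1 : B ≠ 1 := by
    rintro rfl
    -- If `B = 1` the minimiser is the forbidden `t = 1`; a nearby point already violates the bound.
    have := h (3 / 4) (by norm_num)
    norm_num at this
  have h2 := h B hB1
  have : (B - 1 / 2) ^ 2 ≤ 0 := by nlinarith
  have : B - 1 / 2 = 0 := pow_eq_zero_iff (two_ne_zero) |>.1 (le_antisymm this (sq_nonneg _))
  constructor <;> linarith

/-- If all the alternatives with a change at `y` are costly under `α`, then the two groups of arms
in which such an alternative differs from `v` have mass one half each. -/
lemma sum_eq_half_of_le_allocationValue {n : ℕ} {σ : ℝ≥0} (hσ : 0 < σ)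
    {v : Fin (n + 1) → ℝ} {x : Fin n} (hx : x ∈ changePoints v)
    {α : Fin (n + 1) → ℝ} (hα : α ∈ stdSimplex ℝ (Fin (n + 1)))
    (h : ENNReal.ofReal (changeSize v x ^ 2 / (8 * (σ : ℝ) ^ 2)) ≤ allocationValue σ v α)
    {S T : Finset (Fin (n + 1))} (hST : Disjoint S T) (w : ℝ → Fin (n + 1) → ℝ)
    (hw : ∀ t, t ≠ 1 → w t ∈ alternatives v)
    (hdiff : ∀ t i, (v i - w t i) ^ 2 =
      ((if i ∈ S then t ^ 2 else 0) + if i ∈ T then (1 - t) ^ 2 else 0) * changeSize v x ^ 2) :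
    ∑ i ∈ S, α i = 1 / 2 ∧ ∑ i ∈ T, α i = 1 / 2 := by
  have hσ' : (0 : ℝ) < σ := hσ
  have hpos : 0 < changeSize v x ^ 2 :=
    pow_pos (abs_pos.2 (sub_ne_zero.2 (ne_of_mem_changePoints hx))) 2
  refine eq_half_of_quadratic_ge (Finset.sum_nonneg fun i _ ↦ hα.1 i)
    (Finset.sum_nonneg fun i _ ↦ hα.1 i) ?_ fun t ht ↦ ?_
  · rw [← Finset.sum_union hST, ← hα.2]
    exact Finset.sum_le_sum_of_subset_of_nonneg (Finset.subset_univ _) fun i _ _ ↦ hα.1 i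
  · have hle := h.trans (allocationValue_le hσ (hw t ht) hα.1)
    have hsum : ∑ i, α i * (v i - w t i) ^ 2 =
        ((∑ i ∈ S, α i) * t ^ 2 + (∑ i ∈ T, α i) * (1 - t) ^ 2) * changeSize v x ^ 2 := by
      have hterm : ∀ i, α i * (v i - w t i) ^ 2 = ((if i ∈ S then α i else 0) * t ^ 2 +
          (if i ∈ T then α i else 0) * (1 - t) ^ 2) * changeSize v x ^ 2 := by
        intro i
        rw [hdiff]
        split_ifs <;> ring
      simp_rw [hterm, ← Finset.sum_mul, Finset.sum_add_distrib, ← Finset.sum_mul,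
        Finset.sum_ite_mem, Finset.univ_inter]
    rw [hsum, ENNReal.ofReal_le_ofReal_iff (div_nonneg (mul_nonneg (add_nonneg
      (mul_nonneg (Finset.sum_nonneg fun i _ ↦ hα.1 i) (sq_nonneg _))
      (mul_nonneg (Finset.sum_nonneg fun i _ ↦ hα.1 i) (sq_nonneg _))) hpos.le) (by positivity)),
      div_le_div_iff₀ (by positivity) (by positivity)] at hle
    have := le_of_mul_le_mul_right (a := changeSize v x ^ 2 * (8 * (σ : ℝ) ^ 2)) (b := 1 / 4)
      (c := (∑ i ∈ S, α i) * t ^ 2 + (∑ i ∈ T, α i) * (1 - t) ^ 2) (by linarith) (by positivity)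
    exact this

/-- Shift the change one place to the right, with level `a + t (b - a)` before it: the arms up to
`x.castSucc` move by `tΔ` in absolute value up to sign, arm `x.succ` by `(1 - t)Δ`, and the others
stay. -/
lemma sum_Iic_eq_half_of_le_allocationValue {n : ℕ} {σ : ℝ≥0} (hσ : 0 < σ)
    {v : Fin (n + 1) → ℝ} (hv : v ∈ environments n 1) {x : Fin n} (hx : x ∈ changePoints v)
    {α : Fin (n + 1) → ℝ} (hα : α ∈ stdSimplex ℝ (Fin (n + 1)))
    (h : ENNReal.ofReal (changeSize v x ^ 2 / (8 * (σ : ℝ) ^ 2)) ≤ allocationValue σ v α)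
    (hxn : (x : ℕ) + 1 < n) :
    ∑ i ∈ Finset.Iic x.castSucc, α i = 1 / 2 ∧ α x.succ = 1 / 2 := by
  have hne := ne_of_mem_changePoints hx
  have hstep := eq_stepMeans hv hx
  set a := v x.castSucc with ha
  set b := v x.succ with hb
  have hsize : changeSize v x ^ 2 = (a - b) ^ 2 := by rw [changeSize, sq_abs]
  have key := sum_eq_half_of_le_allocationValue hσ hx hα h
    (S := Finset.Iic x.castSucc) (T := {x.succ}) (by simp)
    (fun t ↦ stepMeans ⟨x + 1, hxn⟩ (a + t * (b - a)) b) ?_ ?_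
  · simpa using key
  · intro t ht
    refine stepMeans_mem_alternatives hv hx (by simp [Fin.ext_iff]) fun h ↦ ?_
    have : (t - 1) * (b - a) = 0 := by linarith
    rcases mul_eq_zero.1 this with h | h
    · exact ht (by linarith)
    · exact hne (by linarith)
  · intro t i
    rw [hsize, hstep]
    simp only [stepMeans, Finset.mem_Iic, Finset.mem_singleton, Fin.le_def, Fin.ext_iff,
      Fin.val_castSucc, Fin.val_succ]
    split_ifs <;> first | omega | ring

/-- Mirror image: the change is shifted one place to the left. -/
lemma sum_Ici_eq_half_of_le_allocationValue {n : ℕ} {σ : ℝ≥0} (hσ : 0 < σ)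
    {v : Fin (n + 1) → ℝ} (hv : v ∈ environments n 1) {x : Fin n} (hx : x ∈ changePoints v)
    {α : Fin (n + 1) → ℝ} (hα : α ∈ stdSimplex ℝ (Fin (n + 1)))
    (h : ENNReal.ofReal (changeSize v x ^ 2 / (8 * (σ : ℝ) ^ 2)) ≤ allocationValue σ v α)
    (hx0 : 0 < (x : ℕ)) :
    ∑ i ∈ Finset.Ici x.succ, α i = 1 / 2 ∧ α x.castSucc = 1 / 2 := by
  have hne := ne_of_mem_changePoints hx
  have hstep := eq_stepMeans hv hx
  set a := v x.castSucc with ha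
  set b := v x.succ with hb
  have hsize : changeSize v x ^ 2 = (a - b) ^ 2 := by rw [changeSize, sq_abs]
  have key := sum_eq_half_of_le_allocationValue hσ hx hα h
    (S := Finset.Ici x.succ) (T := {x.castSucc}) (by simp)
    (fun t ↦ stepMeans ⟨x - 1, by omega⟩ a (b + t * (a - b))) ?_ ?_
  · simpa using key
  · intro t ht
    refine stepMeans_mem_alternatives hv hx (by simp [Fin.ext_iff]; omega) fun h ↦ ?_
    have : (t - 1) * (a - b) = 0 := by linarith
    rcases mul_eq_zero.1 this with h | h
    · exact ht (by linarith)
    · exact hne (by linarith)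
  · intro t i
    rw [hsize, hstep]
    simp only [stepMeans, Finset.mem_Ici, Finset.mem_singleton, Fin.le_def, Fin.ext_iff,
      Fin.val_castSucc, Fin.val_succ]
    split_ifs <;> first | omega | ring

lemma eq_evenAllocation {n : ℕ} {x : Fin n} {α : Fin (n + 1) → ℝ}
    (hα : α ∈ stdSimplex ℝ (Fin (n + 1))) (h1 : α x.castSucc = 1 / 2) (h2 : α x.succ = 1 / 2) :
    α = evenAllocation x := by
  have hle : ∀ i ∈ Finset.univ, evenAllocation x i ≤ α i := by
    intro i _
    rw [evenAllocation]
    split_ifs with h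
    · rcases h with rfl | rfl <;> simp [h1, h2]
    · exact hα.1 i
  have := (Finset.sum_eq_sum_iff_of_le hle).1
    ((evenAllocation_mem_stdSimplex x).2.trans hα.2.symm)
  ext i
  exact (this i (Finset.mem_univ i)).symm

lemma eq_evenAllocation_of_le_allocationValue {n : ℕ} (hn : 2 ≤ n) {σ : ℝ≥0} (hσ : 0 < σ)
    {v : Fin (n + 1) → ℝ} (hv : v ∈ environments n 1) {x : Fin n} (hx : x ∈ changePoints v)
    {α : Fin (n + 1) → ℝ} (hα : α ∈ stdSimplex ℝ (Fin (n + 1)))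
    (h : ENNReal.ofReal (changeSize v x ^ 2 / (8 * (σ : ℝ) ^ 2)) ≤ allocationValue σ v α) :
    α = evenAllocation x := by
  have hup := sum_Iic_eq_half_of_le_allocationValue hσ hv hx hα h
  have hdown := sum_Ici_eq_half_of_le_allocationValue hσ hv hx hα h
  refine eq_evenAllocation hα ?_ ?_
  · by_cases hx0 : 0 < (x : ℕ)
    · exact (hdown hx0).2
    -- With no room to the left of `x`, the group of arms up to `x.castSucc` is a single arm, so the
    -- shift to the right fixes its mass as well.
    · rw [← (hup (by omega)).1]
      have : Finset.Iic x.castSucc = {x.castSucc} := by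
        ext i
        simp only [Finset.mem_Iic, Finset.mem_singleton, Fin.le_def, Fin.ext_iff,
          Fin.val_castSucc]
        omega
      simp [this]
  · by_cases hxn : (x : ℕ) + 1 < n
    · exact (hup hxn).2
    · rw [← (hdown (by omega)).1]
      have : Finset.Ici x.succ = {x.succ} := by
        ext i
        simp only [Finset.mem_Ici, Finset.mem_singleton, Fin.le_def, Fin.ext_iff,
          Fin.val_succ]
        omega
      simp [this]

lemma optimalAllocations_eq {n : ℕ} (hn : 2 ≤ n) {σ : ℝ≥0} (hσ : 0 < σ)
    {v : Fin (n + 1) → ℝ} (hv : v ∈ environments n 1) {x : Fin n} (hx : x ∈ changePoints v) :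
    optimalAllocations σ v = {evenAllocation x} := by
  ext α
  rw [Set.mem_singleton_iff]
  constructor
  · rintro ⟨hα, hmax⟩
    exact eq_evenAllocation_of_le_allocationValue hn hσ hv hx hα
      ((le_allocationValue_evenAllocation hσ hv hx).trans
        (hmax (evenAllocation_mem_stdSimplex x)))
  · rintro rfl
    exact ⟨evenAllocation_mem_stdSimplex x, fun β hβ ↦
      (allocationValue_le_of_mem_stdSimplex hn hσ hv hx hβ).trans
        (le_allocationValue_evenAllocation hσ hv hx)⟩

/-! ### Change of measure for the interaction -/

/-- The log-likelihood ratio of one round between the environments `v` and `w`. -/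
def roundLogRatio {n : ℕ} (σ : ℝ≥0) (v w : Fin (n + 1) → ℝ) (o : Fin (n + 1) × ℝ) : ℝ :=
  gaussianLogRatio ((σ ^ 2 : ℝ≥0) : ℝ) (v o.1) (w o.1) o.2

@[fun_prop]
lemma measurable_roundLogRatio {n : ℕ} (σ : ℝ≥0) (v w : Fin (n + 1) → ℝ) :
    Measurable (roundLogRatio σ v w) := by
  have hv : Measurable fun o : Fin (n + 1) × ℝ ↦ v o.1 :=
    (measurable_of_finite v).comp measurable_fst
  have hw : Measurable fun o : Fin (n + 1) × ℝ ↦ w o.1 :=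
    (measurable_of_finite w).comp measurable_fst
  unfold roundLogRatio gaussianLogRatio
  fun_prop

/-- The log-likelihood ratio of the first `t` rounds between the environments `v` and `w`. -/
def cumLogRatio {n : ℕ} (σ : ℝ≥0) (v w : Fin (n + 1) → ℝ) (t : ℕ) (ω : Trajectory n) : ℝ :=
  ∑ s ∈ Finset.range t, roundLogRatio σ v w (ω (s + 1))

/-- `cumLogRatio` as a function of the history. -/
def histLogRatio {n : ℕ} (σ : ℝ≥0) (v w : Fin (n + 1) → ℝ) (t : ℕ) (h : History n t) : ℝ :=
  ∑ s : Fin t, roundLogRatio σ v w (h ⟨s + 1, Finset.mem_Iic.2 s.2⟩)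

lemma histLogRatio_frestrictLe {n : ℕ} (σ : ℝ≥0) (v w : Fin (n + 1) → ℝ) (t : ℕ)
    (ω : Trajectory n) :
    histLogRatio σ v w t (Preorder.frestrictLe t ω) = cumLogRatio σ v w t ω :=
  (Finset.sum_range fun s ↦ roundLogRatio σ v w (ω (s + 1))).symm

lemma measurable_obs_succ {n : ℕ} (s : ℕ) :
    Measurable fun ω : Trajectory n ↦ (ω (s + 1) : Fin (n + 1) × ℝ) :=
  measurable_pi_apply (X := Obs n) (s + 1)

lemma measurable_histLogRatio {n : ℕ} (σ : ℝ≥0) (v w : Fin (n + 1) → ℝ) (t : ℕ) :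
    Measurable (histLogRatio σ v w t) :=
  Finset.measurable_fun_sum _ fun _ _ ↦ (measurable_roundLogRatio σ v w).comp
    (measurable_pi_apply (X := fun i : Finset.Iic t ↦ Obs n i) _)

lemma measurable_roundLogRatio_obs {n : ℕ} (σ : ℝ≥0) (v w : Fin (n + 1) → ℝ) (s : ℕ) :
    Measurable fun ω : Trajectory n ↦ roundLogRatio σ v w (ω (s + 1)) :=
  (measurable_roundLogRatio σ v w).comp (measurable_obs_succ s)

lemma exists_frestrictLe_preimage {n t : ℕ} {B : Set (Trajectory n)}
    (hB : MeasurableSet[obsFiltration n t] B) :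
    ∃ S : Set (History n t), MeasurableSet S ∧ Preorder.frestrictLe t ⁻¹' S = B := by
  rw [Filtration.piLE_eq_comap_frestrictLe] at hB
  exact hB

namespace Policy

variable {n : ℕ} (π : Policy n) {σ : ℝ≥0} (v w : Fin (n + 1) → ℝ)

lemma map_law_compProd (t : ℕ) :
    ((π.law σ v).map (Preorder.frestrictLe t)) ⊗ₘ (π.roundKernel σ v t) =
      (π.law σ v).map fun ω ↦ (Preorder.frestrictLe t ω, ω (t + 1)) :=
  Kernel.map_frestrictLe_trajMeasure_compProd_eq_map_trajMeasure

lemma map_law_zero :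
    (π.law σ v).map (Preorder.frestrictLe 0) =
      π.seedLaw.map (MeasurableEquiv.piUnique (fun i : Finset.Iic 0 ↦ Obs n i)).symm := by
  rw [law, Kernel.trajMeasure, Measure.map_comp _ _ (by fun_prop), Kernel.traj_map_frestrictLe,
    Kernel.partialTraj_self, Measure.id_comp]
  rfl

lemma lintegral_map_law (t : ℕ) {g : History n t → ℝ≥0∞} (hg : Measurable g) :
    ∫⁻ h, g h ∂((π.law σ v).map (Preorder.frestrictLe t)) =
      ∫⁻ ω, g (Preorder.frestrictLe t ω) ∂(π.law σ v) :=
  lintegral_map hg (by fun_prop)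

lemma lintegral_law_succ (t : ℕ) {G : History n t × Obs n (t + 1) → ℝ≥0∞} (hG : Measurable G) :
    ∫⁻ ω, G (Preorder.frestrictLe t ω, ω (t + 1)) ∂(π.law σ v) =
      ∫⁻ h, ∫⁻ o, G (h, o) ∂(π.roundKernel σ v t h)
        ∂((π.law σ v).map (Preorder.frestrictLe t)) := by
  rw [← Measure.lintegral_compProd hG, map_law_compProd, lintegral_map hG (by fun_prop)]

lemma lintegral_roundKernel (t : ℕ) (h : History n t) {g : Fin (n + 1) × ℝ → ℝ≥0∞}
    (hg : Measurable g) :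
    ∫⁻ o, g o ∂(π.roundKernel σ v t h) =
      ∫⁻ a, ∫⁻ r, g (a, r) ∂(gaussianReal (v a) (σ ^ 2)) ∂(π.sampling t h) :=
  Kernel.lintegral_compProd _ _ _ hg

/-- The sampling rule is the same in both environments, so only the reward density contributes. -/
lemma lintegral_roundKernel_change (hσ : 0 < σ) (t : ℕ) (h : History n t)
    {g : Fin (n + 1) × ℝ → ℝ≥0∞} (hg : Measurable g) :
    ∫⁻ o, g o ∂(π.roundKernel σ w t h) =
      ∫⁻ o, ENNReal.ofReal (Real.exp (-roundLogRatio σ v w o)) * g o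
        ∂(π.roundKernel σ v t h) := by
  rw [lintegral_roundKernel _ _ _ _ hg, lintegral_roundKernel _ _ _ _ (by fun_prop)]
  congr 1 with a
  rw [gaussianReal_eq_withDensity (pow_pos hσ 2).ne' (v a) (w a),
    lintegral_withDensity_eq_lintegral_mul _ (measurable_exp_neg_gaussianLogRatio _ _ _)
      (by fun_prop)]
  rfl

/-- The history up to time `t + 1` from the history up to time `t` and the next round. -/
def extendHistory {n : ℕ} (t : ℕ) (p : History n t × Obs n (t + 1)) : History n (t + 1) :=
  IicProdIoc (X := Obs n) t (t + 1) (p.1, MeasurableEquiv.piSingleton (X := Obs n) t p.2)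

lemma measurable_extendHistory (t : ℕ) : Measurable (extendHistory (n := n) t) := by
  unfold extendHistory
  fun_prop

lemma extendHistory_frestrictLe (t : ℕ) (ω : Trajectory n) :
    extendHistory t (Preorder.frestrictLe t ω, ω (t + 1)) = Preorder.frestrictLe (t + 1) ω := by
  ext i
  obtain ⟨i, hi⟩ := i
  by_cases h : i ≤ t
  · simp [extendHistory, IicProdIoc, h]
  · have hi' : i = t + 1 := by
      have := Finset.mem_Iic.1 hi
      omega
    subst hi'
    simp [extendHistory, IicProdIoc, MeasurableEquiv.piSingleton]

lemma lintegral_law_change (hσ : 0 < σ) (t : ℕ) {g : History n t → ℝ≥0∞} (hg : Measurable g) :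
    ∫⁻ ω, g (Preorder.frestrictLe t ω) ∂(π.law σ w) =
      ∫⁻ ω, ENNReal.ofReal (Real.exp (-cumLogRatio σ v w t ω)) * g (Preorder.frestrictLe t ω)
        ∂(π.law σ v) := by
  induction t with
  | zero =>
    simp only [cumLogRatio, Finset.range_zero, Finset.sum_empty, neg_zero, Real.exp_zero,
      ENNReal.ofReal_one, one_mul]
    rw [← π.lintegral_map_law v 0 hg, ← π.lintegral_map_law w 0 hg]
    exact congrArg (fun μ : Measure (History n 0) ↦ ∫⁻ h, g h ∂μ)
      ((π.map_law_zero w).trans (π.map_law_zero v).symm)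
  | succ t ih =>
    have hg' : Measurable fun p ↦ g (extendHistory t p) := hg.comp (measurable_extendHistory t)
    have hR : Measurable fun o : Obs n (t + 1) ↦
        ENNReal.ofReal (Real.exp (-roundLogRatio σ v w o)) :=
      (measurable_roundLogRatio σ v w).neg.exp.ennreal_ofReal
    have hH : Measurable fun h : History n t ↦
        ENNReal.ofReal (Real.exp (-histLogRatio σ v w t h)) :=
      (measurable_histLogRatio σ v w t).neg.exp.ennreal_ofReal
    simp_rw [← extendHistory_frestrictLe]
    rw [π.lintegral_law_succ w t hg', π.lintegral_map_law w t hg'.lintegral_kernel_prod_right',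
      ih hg'.lintegral_kernel_prod_right']
    have hG : Measurable fun p : History n t × Obs n (t + 1) ↦
        ENNReal.ofReal (Real.exp (-histLogRatio σ v w t p.1)) *
          (ENNReal.ofReal (Real.exp (-roundLogRatio σ v w p.2)) * g (extendHistory t p)) :=
      (hH.comp measurable_fst).mul ((hR.comp measurable_snd).mul hg')
    have key := π.lintegral_law_succ (σ := σ) v t hG
    have hsplit : ∀ ω : Trajectory n,
        ENNReal.ofReal (Real.exp (-cumLogRatio σ v w (t + 1) ω)) =
          ENNReal.ofReal (Real.exp (-histLogRatio σ v w t (Preorder.frestrictLe t ω))) *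
            ENNReal.ofReal (Real.exp (-roundLogRatio σ v w (ω (t + 1)))) := by
      intro ω
      rw [histLogRatio_frestrictLe, ← ENNReal.ofReal_mul (Real.exp_pos _).le, ← Real.exp_add,
        cumLogRatio, cumLogRatio, Finset.sum_range_succ, neg_add]
    simp_rw [hsplit, mul_assoc]
    refine Eq.trans ?_ (key.trans
      (π.lintegral_map_law v t hG.lintegral_kernel_prod_right')).symm
    refine lintegral_congr fun ω ↦ ?_
    have hc := hg'.comp (measurable_prodMk_left (x := Preorder.frestrictLe t ω))
    refine Eq.trans ?_ (lintegral_const_mul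
      (ENNReal.ofReal (Real.exp (-histLogRatio σ v w t (Preorder.frestrictLe t ω))))
      (hR.mul hc)).symm
    rw [histLogRatio_frestrictLe]
    exact congrArg _ (π.lintegral_roundKernel_change v w hσ t _ hc)

lemma law_apply_change (hσ : 0 < σ) {t : ℕ} {B : Set (Trajectory n)}
    (hB : MeasurableSet[obsFiltration n t] B) :
    π.law σ w B =
      ∫⁻ ω in B, ENNReal.ofReal (Real.exp (-cumLogRatio σ v w t ω)) ∂(π.law σ v) := by
  have hBm : MeasurableSet B := (obsFiltration n).le t _ hB
  obtain ⟨S, hS, rfl⟩ := exists_frestrictLe_preimage hB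
  have h := π.lintegral_law_change v w hσ t (g := S.indicator 1) (measurable_one.indicator hS)
  rw [← lintegral_indicator hBm, ← lintegral_indicator_one hBm]
  refine Eq.trans ?_ (h.trans ?_)
  · rfl
  · refine lintegral_congr fun ω ↦ ?_
    by_cases hω : Preorder.frestrictLe t ω ∈ S <;> simp [Set.indicator, hω]

/-! ### The stopped log-likelihood ratio -/

/-- The log-likelihood ratio of the rounds played up to time `t`. -/
def stoppedLogRatio (π : Policy n) (σ : ℝ≥0) (v w : Fin (n + 1) → ℝ) (t : ℕ)
    (ω : Trajectory n) : ℝ :=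
  ∑ s ∈ Finset.range t,
    {ω | (s : ℕ∞) < π.stoppingTime ω}.indicator (fun ω ↦ roundLogRatio σ v w (ω (s + 1))) ω

lemma stoppedLogRatio_of_stoppingTime_eq {s t : ℕ} (hst : s ≤ t) {ω : Trajectory n}
    (h : π.stoppingTime ω = s) : π.stoppedLogRatio σ v w t ω = cumLogRatio σ v w s ω := by
  rw [stoppedLogRatio, cumLogRatio, ← Finset.sum_subset (Finset.range_subset_range.2 hst)]
  · refine Finset.sum_congr rfl fun i hi ↦ Set.indicator_of_mem ?_ _
    simpa [h] using hi
  · intro i _ hi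
    refine Set.indicator_of_notMem ?_ _
    simpa [h] using hi

lemma stoppedLogRatio_of_lt_stoppingTime {t : ℕ} {ω : Trajectory n}
    (h : (t : ℕ∞) < π.stoppingTime ω) :
    π.stoppedLogRatio σ v w t ω = cumLogRatio σ v w t ω := by
  refine Finset.sum_congr rfl fun i hi ↦ Set.indicator_of_mem ?_ _
  exact lt_trans (by exact_mod_cast Finset.mem_range.1 hi) h

lemma measurableSet_lt_stoppingTime (s : ℕ) :
    MeasurableSet[obsFiltration n s] {ω | (s : ℕ∞) < π.stoppingTime ω} := by
  have := (π.isStoppingTime s).compl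
  convert this using 1
  ext ω
  exact (not_le (a := π.stoppingTime ω) (b := (s : ℕ∞))).symm

/-- Change of measure at the stopping time truncated at `t`, for events of the stopped
`σ`-algebra that imply stopping by time `t`. -/
lemma law_inter_le_apply_change (hσ : 0 < σ) (t : ℕ) {B : Set (Trajectory n)}
    (hB : MeasurableSet[π.isStoppingTime.measurableSpace] B) :
    π.law σ w (B ∩ {ω | π.stoppingTime ω ≤ t}) =
      ∫⁻ ω in B ∩ {ω | π.stoppingTime ω ≤ t},
        ENNReal.ofReal (Real.exp (-π.stoppedLogRatio σ v w t ω)) ∂(π.law σ v) := by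
  -- On `τ = s` the stopped ratio is the ordinary one at time `s`, and this part of `B` is decided
  -- by the first `s` rounds.
  have hunion : B ∩ {ω | π.stoppingTime ω ≤ t} =
      ⋃ s ∈ Finset.range (t + 1), B ∩ {ω | π.stoppingTime ω = (s : ℕ∞)} := by
    ext ω
    simp only [Set.mem_inter_iff, Set.mem_ofPred_eq, Set.mem_iUnion, Finset.mem_range,
      exists_prop]
    constructor
    · rintro ⟨h, hle⟩
      lift π.stoppingTime ω to ℕ using ne_top_of_le_ne_top (ENat.natCast_ne_top t) hle with k hk
      exact ⟨k, Nat.lt_succ_of_le (by exact_mod_cast hle), h, rfl⟩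
    · rintro ⟨s, hs, h, heq⟩
      exact ⟨h, by rw [heq]; exact_mod_cast Nat.le_of_lt_succ hs⟩
  have hmeas : ∀ s : ℕ, MeasurableSet[obsFiltration n s]
      (B ∩ {ω | π.stoppingTime ω = (s : ℕ∞)}) := fun s ↦
    (π.isStoppingTime.measurableSet_inter_eq_iff B s).1
      (hB.inter (π.isStoppingTime.measurableSet_eq_of_countable' s))
  have hdisj : (↑(Finset.range (t + 1)) : Set ℕ).PairwiseDisjoint
      fun s ↦ B ∩ {ω | π.stoppingTime ω = (s : ℕ∞)} := by
    intro i _ j _ hij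
    refine Set.disjoint_left.2 fun ω h1 h2 ↦ hij ?_
    exact_mod_cast h1.2.symm.trans h2.2
  rw [hunion, measure_biUnion_finset hdisj fun s _ ↦ (obsFiltration n).le s _ (hmeas s),
    lintegral_biUnion_finset hdisj fun s _ ↦ (obsFiltration n).le s _ (hmeas s)]
  refine Finset.sum_congr rfl fun s hs ↦ ?_
  rw [π.law_apply_change v w hσ (hmeas s)]
  refine setLIntegral_congr_fun ((obsFiltration n).le s _ (hmeas s)) fun ω hω ↦ ?_
  rw [π.stoppedLogRatio_of_stoppingTime_eq v w (Nat.le_of_lt_succ (Finset.mem_range.1 hs)) hω.2]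

/-- On `τ ≤ t` and on `t < τ` the weight turns the law under `v` into the law under `w`, whose two
masses add up to one. -/
lemma lintegral_exp_neg_stoppedLogRatio (hσ : 0 < σ) (t : ℕ) :
    ∫⁻ ω, ENNReal.ofReal (Real.exp (-π.stoppedLogRatio σ v w t ω)) ∂(π.law σ v) = 1 := by
  have hlt := π.measurableSet_lt_stoppingTime t
  have hltm := (obsFiltration n).le t _ hlt
  have hcompl : {ω | (t : ℕ∞) < π.stoppingTime ω}ᶜ =
      Set.univ ∩ {ω | π.stoppingTime ω ≤ t} := by
    ext ω
    simp
  rw [← lintegral_add_compl _ hltm, hcompl, ← π.law_inter_le_apply_change v w hσ t MeasurableSet.univ,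
    ← hcompl, setLIntegral_congr_fun hltm
      (g := fun ω ↦ ENNReal.ofReal (Real.exp (-cumLogRatio σ v w t ω)))
      (fun ω hω ↦ by simp only [π.stoppedLogRatio_of_lt_stoppingTime v w hω]),
    ← π.law_apply_change v w hσ hlt, measure_add_measure_compl hltm, measure_univ]

end Policy

/-! ### Expectation of the stopped log-likelihood ratio -/

namespace Policy

variable {n : ℕ} (π : Policy n) {σ : ℝ≥0} (v w : Fin (n + 1) → ℝ)

/-- Summing over the finitely many arms gives a bound uniform in the history, which makes the ratio
integrable under the whole law. -/
lemma exists_lintegral_enorm_roundLogRatio_le (hσ : 0 < σ) :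
    ∃ C : ℝ≥0∞, C < ⊤ ∧ ∀ t h,
      ∫⁻ o, ‖roundLogRatio σ v w o‖ₑ ∂(π.roundKernel σ v t h) ≤ C := by
  refine ⟨∑ a, ∫⁻ r, ‖roundLogRatio σ v w (a, r)‖ₑ ∂(gaussianReal (v a) (σ ^ 2)), ?_,
    fun t h ↦ ?_⟩
  · exact ENNReal.sum_lt_top.2 fun a _ ↦
      (integrable_gaussianLogRatio (pow_pos hσ 2).ne' (v a) (w a)).2
  · rw [π.lintegral_roundKernel v t h (measurable_roundLogRatio σ v w).enorm]
    refine (lintegral_mono fun a ↦ Finset.single_le_sum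
      (f := fun a ↦ ∫⁻ r, ‖roundLogRatio σ v w (a, r)‖ₑ ∂(gaussianReal (v a) (σ ^ 2)))
      (fun _ _ ↦ zero_le) (Finset.mem_univ a)).trans ?_
    simp

lemma integrable_roundLogRatio (hσ : 0 < σ) (t : ℕ) (h : History n t) :
    Integrable (roundLogRatio σ v w) (π.roundKernel σ v t h) := by
  obtain ⟨C, hC, hle⟩ := π.exists_lintegral_enorm_roundLogRatio_le v w hσ
  exact ⟨(measurable_roundLogRatio σ v w).aestronglyMeasurable, (hle t h).trans_lt hC⟩

/-- Given the history, the mean is an average over the sampled arm of the divergences `(v a - w a)²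
/ (2σ²)`. -/
lemma integral_roundLogRatio_le (hσ : 0 < σ) {c : ℝ}
    (hc : ∀ i, (v i - w i) ^ 2 / (2 * (σ : ℝ) ^ 2) ≤ c) (t : ℕ) (h : History n t) :
    ∫ o, roundLogRatio σ v w o ∂(π.roundKernel σ v t h) ≤ c := by
  have hint : ∫ o, roundLogRatio σ v w o ∂(π.roundKernel σ v t h) =
      ∫ a, ∫ r, roundLogRatio σ v w (a, r) ∂(gaussianReal (v a) (σ ^ 2)) ∂(π.sampling t h) :=
    integral_compProd (π.integrable_roundLogRatio v w hσ t h)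
  have hinner : ∀ a, ∫ r, roundLogRatio σ v w (a, r) ∂(gaussianReal (v a) (σ ^ 2)) =
      (v a - w a) ^ 2 / (2 * (σ : ℝ) ^ 2) := by
    intro a
    have := integral_gaussianLogRatio (pow_pos hσ 2).ne' (v a) (w a)
    simpa [roundLogRatio] using this
  simp_rw [hint, hinner]
  refine (integral_mono (Integrable.of_finite) (integrable_const c) hc).trans_eq ?_
  simp

lemma integrable_roundLogRatio_law (hσ : 0 < σ) (t : ℕ) :
    Integrable (fun ω ↦ roundLogRatio σ v w (ω (t + 1))) (π.law σ v) := by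
  obtain ⟨C, hC, hle⟩ := π.exists_lintegral_enorm_roundLogRatio_le v w hσ
  refine ⟨(measurable_roundLogRatio_obs σ v w t).aestronglyMeasurable, lt_of_le_of_lt ?_ hC⟩
  have hG : Measurable fun p : History n t × Obs n (t + 1) ↦ ‖roundLogRatio σ v w p.2‖ₑ :=
    (measurable_roundLogRatio σ v w).enorm.comp measurable_snd
  have : IsProbabilityMeasure ((π.law σ v).map (Preorder.frestrictLe t)) :=
    Measure.isProbabilityMeasure_map (by fun_prop)
  refine (π.lintegral_law_succ v t hG).trans_le ((lintegral_mono fun h ↦ hle t h).trans ?_)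
  simp

lemma integrable_stoppedLogRatio (hσ : 0 < σ) (t : ℕ) :
    Integrable (π.stoppedLogRatio σ v w t) (π.law σ v) :=
  integrable_finsetSum _ fun s _ ↦ (π.integrable_roundLogRatio_law v w hσ s).indicator
    ((obsFiltration n).le s _ (π.measurableSet_lt_stoppingTime s))

/-- Since `B` is decided before round `t + 1`, one may condition on the history. This is applied to
`B = {t < τ}`. -/
lemma integral_indicator_roundLogRatio_le (hσ : 0 < σ) {c : ℝ}
    (hc : ∀ i, (v i - w i) ^ 2 / (2 * (σ : ℝ) ^ 2) ≤ c) {t : ℕ} {B : Set (Trajectory n)}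
    (hB : MeasurableSet[obsFiltration n t] B) :
    ∫ ω, B.indicator (fun ω ↦ roundLogRatio σ v w (ω (t + 1))) ω ∂(π.law σ v) ≤
      c * (π.law σ v).real B := by
  have hBm : MeasurableSet B := (obsFiltration n).le t _ hB
  obtain ⟨S, hS, rfl⟩ := exists_frestrictLe_preimage hB
  have hpm : IsProbabilityMeasure ((π.law σ v).map (Preorder.frestrictLe t)) :=
    Measure.isProbabilityMeasure_map (by fun_prop)
  set f : History n t × Obs n (t + 1) → ℝ :=
    (Prod.fst ⁻¹' S).indicator fun p ↦ roundLogRatio σ v w p.2 with hf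
  have hfm : Measurable f := ((measurable_roundLogRatio σ v w).comp measurable_snd).indicator
    (measurable_fst hS)
  have hpair : Measurable fun ω : Trajectory n ↦ (Preorder.frestrictLe t ω, ω (t + 1)) := by
    fun_prop
  have hfeq : (fun ω : Trajectory n ↦ f (Preorder.frestrictLe t ω, ω (t + 1))) =
      (Preorder.frestrictLe t ⁻¹' S).indicator
        (fun ω ↦ roundLogRatio σ v w (ω (t + 1))) := rfl
  have hfi : Integrable f (((π.law σ v).map (Preorder.frestrictLe t)) ⊗ₘ
      (π.roundKernel σ v t)) := by
    rw [map_law_compProd]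
    refine (integrable_map_measure hfm.aestronglyMeasurable hpair.aemeasurable).2 ?_
    exact (π.integrable_roundLogRatio_law v w hσ t).indicator hBm
  have hinner : ∀ h, ∫ o, f (h, o) ∂(π.roundKernel σ v t h) ≤ S.indicator (fun _ ↦ c) h := by
    intro h
    by_cases hh : h ∈ S
    · simpa [hf, Set.indicator, hh] using π.integral_roundLogRatio_le v w hσ hc t h
    · simp [hf, Set.indicator, hh]
  calc ∫ ω, (Preorder.frestrictLe t ⁻¹' S).indicator
        (fun ω ↦ roundLogRatio σ v w (ω (t + 1))) ω ∂(π.law σ v)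
      = ∫ p, f p ∂(((π.law σ v).map (Preorder.frestrictLe t)) ⊗ₘ (π.roundKernel σ v t)) := by
        rw [map_law_compProd, integral_map hpair.aemeasurable hfm.aestronglyMeasurable]
        rfl
    _ = ∫ h, ∫ o, f (h, o) ∂(π.roundKernel σ v t h)
          ∂((π.law σ v).map (Preorder.frestrictLe t)) := Measure.integral_compProd hfi
    _ ≤ ∫ h, S.indicator (fun _ ↦ c) h ∂((π.law σ v).map (Preorder.frestrictLe t)) :=
        integral_mono hfi.integral_compProd ((integrable_const c).indicator hS) hinner
    _ = c * (π.law σ v).real (Preorder.frestrictLe t ⁻¹' S) := by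
        rw [integral_indicator_const _ hS, map_measureReal_apply (by fun_prop) hS, smul_eq_mul,
          mul_comm]

lemma integral_stoppedLogRatio_le (hσ : 0 < σ) {c : ℝ}
    (hc : ∀ i, (v i - w i) ^ 2 / (2 * (σ : ℝ) ^ 2) ≤ c) (t : ℕ) :
    ∫ ω, π.stoppedLogRatio σ v w t ω ∂(π.law σ v) ≤
      c * ∑ s ∈ Finset.range t, (π.law σ v).real {ω | (s : ℕ∞) < π.stoppingTime ω} := by
  simp only [stoppedLogRatio]
  rw [integral_finsetSum _ fun s _ ↦ (π.integrable_roundLogRatio_law v w hσ s).indicator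
    ((obsFiltration n).le s _ (π.measurableSet_lt_stoppingTime s)), Finset.mul_sum]
  exact Finset.sum_le_sum fun s _ ↦
    π.integral_indicator_roundLogRatio_le v w hσ hc (π.measurableSet_lt_stoppingTime s)

/-- The sum is the expectation of the number of `s < t` with `s < τ`, that is, of `min τ t`. -/
lemma sum_range_lt_stoppingTime_le_expectedStop (t : ℕ) :
    ENNReal.ofReal (∑ s ∈ Finset.range t, (π.law σ v).real {ω | (s : ℕ∞) < π.stoppingTime ω}) ≤
      π.expectedStop σ v := by
  have hm : ∀ s : ℕ, MeasurableSet {ω | (s : ℕ∞) < π.stoppingTime ω} := fun s ↦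
    (obsFiltration n).le s _ (π.measurableSet_lt_stoppingTime s)
  rw [ENNReal.ofReal_sum_of_nonneg fun _ _ ↦ measureReal_nonneg]
  have hreal : ∀ s : ℕ, ENNReal.ofReal ((π.law σ v).real {ω | (s : ℕ∞) < π.stoppingTime ω}) =
      ∫⁻ ω, {ω | (s : ℕ∞) < π.stoppingTime ω}.indicator 1 ω ∂(π.law σ v) := fun s ↦ by
    rw [ofReal_measureReal, lintegral_indicator_one (hm s)]
  simp_rw [hreal]
  rw [← lintegral_finsetSum _ fun s _ ↦ measurable_one.indicator (hm s)]
  refine lintegral_mono fun ω ↦ ?_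
  have hsum : ∑ s ∈ Finset.range t,
      {ω | (s : ℕ∞) < π.stoppingTime ω}.indicator (1 : Trajectory n → ℝ≥0∞) ω =
      ((Finset.range t).filter fun s : ℕ ↦ (s : ℕ∞) < π.stoppingTime ω).card := by
    rw [Finset.card_filter]
    push_cast
    exact Finset.sum_congr rfl fun s _ ↦ by simp [Set.indicator]
  rw [hsum]
  cases hτ : π.stoppingTime ω with
  | top => simp
  | coe k =>
    have hsub : ((Finset.range t).filter fun s : ℕ ↦ (s : ℕ∞) < (k : ℕ∞)) ⊆ Finset.range k := by
      intro s hs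
      simpa using (Finset.mem_filter.1 hs).2
    have := (Finset.card_le_card hsub).trans_eq (Finset.card_range k)
    simpa using this

end Policy

/-! ### The Bretagnolle–Huber inequality -/

/-- The Bretagnolle–Huber inequality for a change of measure with density `exp (-L)`. -/
lemma bretagnolle_huber {Ω : Type*} [MeasurableSpace Ω] (P : Measure Ω) [IsProbabilityMeasure P]
    {L : Ω → ℝ} (hL : Integrable L P)
    (h1 : ∫⁻ ω, ENNReal.ofReal (Real.exp (-L ω)) ∂P = 1) {A : Set Ω} (hA : MeasurableSet A) :
    1 / 2 * Real.exp (-∫ ω, L ω ∂P) ≤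
      P.real Aᶜ + (∫⁻ ω in A, ENNReal.ofReal (Real.exp (-L ω)) ∂P).toReal := by
  set m := ∫ ω, L ω ∂P with hm
  set q := Real.exp (-m / 2) with hq
  have hqpos : 0 < q := Real.exp_pos _
  have hmeas : AEStronglyMeasurable (fun ω ↦ Real.exp (-L ω)) P :=
    Real.continuous_exp.comp_aestronglyMeasurable hL.1.neg
  have hnonneg : ∀ μ : Measure Ω, 0 ≤ᵐ[μ] fun ω ↦ Real.exp (-L ω) := fun μ ↦
    ae_of_all _ fun ω ↦ (Real.exp_pos _).le
  have hY : Integrable (fun ω ↦ Real.exp (-L ω)) P := by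
    refine ⟨hmeas, ?_⟩
    rw [hasFiniteIntegral_iff_ofReal (hnonneg P), h1]
    exact ENNReal.one_lt_top
  have hY1 : ∫ ω, Real.exp (-L ω) ∂P = 1 := by
    rw [integral_eq_lintegral_of_nonneg_ae (hnonneg P) hmeas, h1, ENNReal.toReal_one]
  have hYA : (∫⁻ ω in A, ENNReal.ofReal (Real.exp (-L ω)) ∂P).toReal =
      ∫ ω, A.indicator (fun ω ↦ Real.exp (-L ω)) ω ∂P := by
    rw [integral_indicator hA, integral_eq_lintegral_of_nonneg_ae (hnonneg _) hmeas.restrict]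
  have hPA : P.real Aᶜ = ∫ ω, Aᶜ.indicator (fun _ ↦ (1 : ℝ)) ω ∂P := by
    rw [integral_indicator_const _ hA.compl]; simp
  have hi1 : Integrable (Aᶜ.indicator fun _ ↦ (1 : ℝ)) P :=
    (integrable_const _).indicator hA.compl
  have hi2 : Integrable (A.indicator fun ω ↦ Real.exp (-L ω)) P := hY.indicator hA
  -- With `z = exp (-L / 2)`, the left side is below `z` by the tangent line of the exponential at
  -- `m`. As `z² = min 1 z² * max 1 z²` and `max 1 z² ≤ 1 + z²`, the weighted AM-GM inequality
  -- bounds `z` by `min 1 z² / q + q (1 + z²) / 4`. Integrating gives `q` on the left and a term `q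
  -- / 2` on the right, which is absorbed.
  have hpt : ∀ ω, q * (1 - (L ω - m) / 2) ≤
      1 / q * (Aᶜ.indicator (fun _ ↦ (1 : ℝ)) ω + A.indicator (fun ω ↦ Real.exp (-L ω)) ω) +
        q / 4 * (1 + Real.exp (-L ω)) := by
    intro ω
    set z := Real.exp (-L ω / 2) with hz
    have hzpos : 0 < z := Real.exp_pos _
    have hz2 : Real.exp (-L ω) = z ^ 2 := by
      rw [hz, ← Real.exp_nat_mul]; congr 1; push_cast; ring
    have htangent : q * (1 - (L ω - m) / 2) ≤ z := by
      have hsplit : z = q * Real.exp (-(L ω - m) / 2) := by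
        rw [hz, hq, ← Real.exp_add]; congr 1; ring
      rw [hsplit]
      have := Real.add_one_le_exp (-(L ω - m) / 2)
      gcongr
      linarith
    refine htangent.trans ?_
    have hmin : min 1 (z ^ 2) ≤
        Aᶜ.indicator (fun _ ↦ (1 : ℝ)) ω + A.indicator (fun ω ↦ Real.exp (-L ω)) ω := by
      by_cases hω : ω ∈ A <;> simp [hω, hz2]
    have hmain : z ≤ 1 / q * min 1 (z ^ 2) + q / 4 * (1 + z ^ 2) := by
      have hmul : z * q ≤ min 1 (z ^ 2) + q ^ 2 / 4 * (1 + z ^ 2) := by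
        rcases le_total 1 (z ^ 2) with h | h
        · rw [min_eq_left h]
          nlinarith [sq_nonneg (z * q / 2 - 1), sq_nonneg q]
        · rw [min_eq_right h]
          nlinarith [sq_nonneg (z - q / 2), mul_nonneg (sq_nonneg q) (sq_nonneg z)]
      have : 1 / q * min 1 (z ^ 2) + q / 4 * (1 + z ^ 2) =
          (min 1 (z ^ 2) + q ^ 2 / 4 * (1 + z ^ 2)) / q := by
        field_simp
      rw [this, le_div_iff₀ hqpos]
      exact hmul
    rw [hz2]
    refine hmain.trans ?_
    gcongr
  have hi3 : Integrable (fun ω ↦ (L ω - m) / 2) P := (hL.sub (integrable_const m)).div_const 2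
  have hi4 : Integrable (fun ω ↦ q * (1 - (L ω - m) / 2)) P :=
    ((integrable_const 1).sub hi3).const_mul q
  have hi5 : Integrable (fun ω ↦ 1 / q * (Aᶜ.indicator (fun _ ↦ (1 : ℝ)) ω +
      A.indicator (fun ω ↦ Real.exp (-L ω)) ω)) P := (hi1.add hi2).const_mul (1 / q)
  have hi6 : Integrable (fun ω ↦ q / 4 * (1 + Real.exp (-L ω))) P :=
    ((integrable_const 1).add hY).const_mul (q / 4)
  have hint := integral_mono hi4 (hi5.add hi6) hpt
  have hleft : ∫ ω, q * (1 - (L ω - m) / 2) ∂P = q := by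
    rw [integral_const_mul, integral_sub (integrable_const _) hi3, integral_div,
      integral_sub hL (integrable_const _)]
    simp [← hm]
  have hright : ∫ ω, (1 / q * (Aᶜ.indicator (fun _ ↦ (1 : ℝ)) ω +
      A.indicator (fun ω ↦ Real.exp (-L ω)) ω) + q / 4 * (1 + Real.exp (-L ω))) ∂P =
      1 / q * (P.real Aᶜ + (∫⁻ ω in A, ENNReal.ofReal (Real.exp (-L ω)) ∂P).toReal) + q / 2 := by
    rw [integral_add hi5 hi6, integral_const_mul, integral_const_mul, integral_add hi1 hi2, integral_add (integrable_const _) hY, hY1, hYA, hPA]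
    simp
    ring
  have hq2 : q ^ 2 = Real.exp (-m) := by
    rw [hq, ← Real.exp_nat_mul]; congr 1; push_cast; ring
  rw [← hq2]
  have hfin : q ≤ 1 / q * (P.real Aᶜ +
      (∫⁻ ω in A, ENNReal.ofReal (Real.exp (-L ω)) ∂P).toReal) + q / 2 :=
    hleft.symm.trans_le (hint.trans_eq hright)
  have := mul_le_mul_of_nonneg_left hfin hqpos.le
  rw [mul_add, ← mul_assoc, mul_one_div_cancel hqpos.ne', one_mul] at this
  nlinarith

/-! ### The lower bound on the expected stopping time -/

namespace Policy

variable {n : ℕ} (π : Policy n) {σ : ℝ≥0}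

/-- The change of measure requires stopping by time `t`; this restriction is kept under `v` and
dropped under `w`, where it only helps. -/
lemma half_exp_neg_le (hσ : 0 < σ) (v w : Fin (n + 1) → ℝ) {c : ℝ}
    (hc : ∀ i, (v i - w i) ^ 2 / (2 * (σ : ℝ) ^ 2) ≤ c) (t : ℕ) {B : Set (Trajectory n)}
    (hB : MeasurableSet[π.isStoppingTime.measurableSpace] B) :
    1 / 2 * Real.exp (-(c *
        ∑ s ∈ Finset.range t, (π.law σ v).real {ω | (s : ℕ∞) < π.stoppingTime ω})) ≤
      (π.law σ v).real (B ∩ {ω | π.stoppingTime ω ≤ t})ᶜ + (π.law σ w).real B := by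
  have hBm : MeasurableSet (B ∩ {ω | π.stoppingTime ω ≤ t}) :=
    (obsFiltration n).le t _ (hB.2 t)
  have hBH := bretagnolle_huber (π.law σ v) (π.integrable_stoppedLogRatio v w hσ t)
    (π.lintegral_exp_neg_stoppedLogRatio v w hσ t) hBm
  rw [← π.law_inter_le_apply_change v w hσ t hB] at hBH
  calc _ ≤ 1 / 2 * Real.exp (-∫ ω, π.stoppedLogRatio σ v w t ω ∂(π.law σ v)) := by
        gcongr
        exact π.integral_stoppedLogRatio_le v w hσ hc t
    _ ≤ _ := hBH
    _ ≤ _ := by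
        gcongr
        exact measureReal_mono Set.inter_subset_left

lemma tendsto_real_inter_le (v : Fin (n + 1) → ℝ)
    (hfin : ∀ᵐ ω ∂(π.law σ v), π.stoppingTime ω < ⊤) (B : Set (Trajectory n)) :
    Filter.Tendsto (fun t : ℕ ↦ (π.law σ v).real (B ∩ {ω | π.stoppingTime ω ≤ t}))
      Filter.atTop (nhds ((π.law σ v).real B)) := by
  have hmono : Monotone fun t : ℕ ↦ B ∩ {ω | π.stoppingTime ω ≤ t} := fun s t hst ω hω ↦
    ⟨hω.1, le_trans hω.2 (show (s : ℕ∞) ≤ t by exact_mod_cast hst)⟩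
  have hlim := tendsto_measure_iUnion_atTop (μ := π.law σ v) hmono
  have hunion : (⋃ t : ℕ, B ∩ {ω | π.stoppingTime ω ≤ t}) =ᵐ[π.law σ v] B := by
    filter_upwards [hfin] with ω hω
    refine propext ⟨fun h ↦ ?_, fun h ↦ ?_⟩
    · obtain ⟨t, ht⟩ := Set.mem_iUnion.1 h
      exact ht.1
    · lift π.stoppingTime ω to ℕ using hω.ne with k hk
      exact Set.mem_iUnion.2 ⟨k, h, hk.ge⟩
  rw [measure_congr hunion] at hlim
  exact (ENNReal.tendsto_toReal (measure_ne_top _ _)).comp hlim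

theorem le_expectedStop {n : ℕ} (hn : 2 ≤ n) {σ : ℝ≥0} (hσ : 0 < σ)
    {v : Fin (n + 1) → ℝ} (hv : v ∈ environments n 1) {x : Fin n} (hx : x ∈ changePoints v)
    {δ : ℝ} (hδ : 0 < δ) (π : Policy n) (hπ : π.IsExactOne σ δ) :
    ENNReal.ofReal (8 * (σ : ℝ) ^ 2 / changeSize v x ^ 2 * Real.log (1 / (4 * δ))) ≤
      π.expectedStop σ v := by
  have hσ' : (0 : ℝ) < σ := hσ
  have hpos : 0 < changeSize v x ^ 2 :=
    pow_pos (abs_pos.2 (sub_ne_zero.2 (ne_of_mem_changePoints hx))) 2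
  obtain ⟨y, hyx, w, hw, hyw, hnear⟩ := exists_alternative_near hn hv hx
  have hmeas : ∀ z, MeasurableSet[π.isStoppingTime.measurableSpace] {ω | π.estimate ω = z} :=
    fun z ↦ π.measurable_estimate (measurableSet_singleton z)
  have hmeas' : ∀ z, MeasurableSet {ω | π.estimate ω = z} := fun z ↦
    π.isStoppingTime.measurableSpace_le _ (hmeas z)
  obtain ⟨hvx, hvfin⟩ := hπ v hv
  have hwy := (hπ w hw.1).1 y hyw
  have hwx : (π.law σ w).real {ω | π.estimate ω = x} < δ := by
    have hsub : {ω | π.estimate ω = x} ⊆ {ω | π.estimate ω = y}ᶜ := fun ω hω hω' ↦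
      hyx (hω'.symm.trans hω)
    have := measureReal_mono (μ := π.law σ w) hsub
    rw [probReal_compl_eq_one_sub (hmeas' y)] at this
    linarith
  -- The strict inequality in exactness survives truncation at a large `t`, because `τ` is almost
  -- surely finite under `v`.
  obtain ⟨t, ht⟩ := ((π.tendsto_real_inter_le v hvfin _).eventually_const_lt (hvx x hx)).exists
  set c := changeSize v x ^ 2 / (8 * (σ : ℝ) ^ 2) with hc_def
  have hcpos : 0 < c := by positivity
  have hc : ∀ i, (v i - w i) ^ 2 / (2 * (σ : ℝ) ^ 2) ≤ c := by
    intro i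
    rw [hc_def, div_le_div_iff₀ (by positivity) (by positivity)]
    nlinarith [hnear i, sq_nonneg (σ : ℝ)]
  have hBH := π.half_exp_neg_le hσ v w hc t (hmeas x)
  have hmeas_t : MeasurableSet ({ω | π.estimate ω = x} ∩ {ω | π.stoppingTime ω ≤ (t : ℕ∞)}) :=
    (obsFiltration n).le t _ ((hmeas x).2 t)
  rw [probReal_compl_eq_one_sub hmeas_t] at hBH
  refine le_trans (ENNReal.ofReal_le_ofReal ?_) (π.sum_range_lt_stoppingTime_le_expectedStop v t)
  set M := ∑ s ∈ Finset.range t, (π.law σ v).real {ω | (s : ℕ∞) < π.stoppingTime ω}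
  -- Both probabilities on the right of `hBH` are below `δ`, and the factor `1 / 2` doubles their
  -- sum.
  have hexp : Real.exp (-(c * M)) < 4 * δ := by linarith
  have hlog : Real.log (1 / (4 * δ)) ≤ c * M := by
    rw [one_div, Real.log_inv, neg_le]
    exact ((Real.lt_log_iff_exp_lt (by positivity)).2 hexp).le
  have hinv : 8 * (σ : ℝ) ^ 2 / changeSize v x ^ 2 = c⁻¹ := by rw [hc_def, inv_div]
  rw [hinv, inv_mul_le_iff₀ hcpos]
  exact hlog

end Policy

end

end ChangePointBandit

theorem mainTheorem5 (n : ℕ) (hn : 2 ≤ n) (σ : ℝ≥0) (hσ : 0 < σ)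
    (v : Fin (n + 1) → ℝ) (hv : v ∈ ChangePointBandit.environments n 1)
    (x : Fin n) (hx : x ∈ ChangePointBandit.changePoints v) :
    (∀ δ : ℝ, 0 < δ → δ < 1 →
      ∀ π : ChangePointBandit.Policy n, π.IsExactOne σ δ →
        ENNReal.ofReal
            (8 * (σ : ℝ) ^ 2 / ChangePointBandit.changeSize v x ^ 2 * Real.log (1 / (4 * δ)))
          ≤ π.expectedStop σ v) ∧
    ChangePointBandit.optimalAllocations σ v =
      {fun i : Fin (n + 1) => if i = x.castSucc ∨ i = x.succ then (1 / 2 : ℝ) else 0} ∧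
    (ChangePointBandit.cStar σ v)⁻¹ =
      ENNReal.ofReal (ChangePointBandit.changeSize v x ^ 2 / (8 * (σ : ℝ) ^ 2)) := by
  refine ⟨fun δ hδ _ π hπ ↦ ChangePointBandit.Policy.le_expectedStop hn hσ hv hx hδ π hπ,
    ChangePointBandit.optimalAllocations_eq hn hσ hv hx, ?_⟩
  rw [ChangePointBandit.cStar, inv_inv, ChangePointBandit.iSup_allocationValue hn hσ hv hx]
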